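/- Let $\mathbb K$ be a field, $n\ge 0$ and $a_1,\dots,a_n$ positive integers, let $R=\mathbb K[x_{i_1,\dots,i_n} : 1\le i_j\le a_j]$, and let $A=(x_{i_1,\dots,i_n})$ be the generic $a_1\times\dots\times a_n$ table. For $J\subseteq\{1,\dots,n\}$ let $A_J$ be the $J$-margin of $A$, i.e. the table indexed by $(i_j)_{j\in J}$ whose entries are obtained from $A$ by summing over all indices outside $J$. Let $L_J\subseteq R$ be the ideal generated by the entries of $A_J$, and let $I(A_J)\subseteq R$ be the ideal generated by the generalized $2\times 2$ minors of $A_J$, i.e. by all elements $b_pb_q-b_{p'}b_{q'}$, where $b$ denotes entries of $A_J$ and $p',q'$ arise from the multi-indices $p,q$ by exchanging one coordinate. For a collection $\Delta$ of subsets of $\{1,\dots,n\}$ put $I_\Delta=\sum_{J\in\Delta}I(A_J)$. Let $S_\Delta$ be the polynomial ring over $\mathbb K$ with one variable for each entry of each margin $A_J$, $J\in\Delta$, let $\tau_\Delta:S_\Delta\to R$ send each variable to the corresponding margin entry, and let $\sigma_\Delta$ be the composite of $\tau_\Delta$ with the Segre map $R\to\mathbb K[y_{j,i} : 1\le j\le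 n,\ 1\le i\le a_j]$, $x_{i_1,\dots,i_n}\mapsto\prod_j y_{j,i_j}$. Let $P_\Delta\subseteq R$ be the ideal generated by $\tau_\Delta(\ker\sigma_\Delta)$. For $j\in\{1,\dots,n\}$ let $\Delta(j)=\{J\in\Delta : j\in J\}$. Let $\Delta$ be a graph, i.e. a simplicial complex on vertices among $\{1,\dots,n\}$ all of whose facets have exactly two elements (they are the edges). Then every minimal prime of $I_\Delta$ is either $P_\Delta$ or of the form $$I_\Delta+\sum_{j\notin\Gamma}P_{\Delta(j)}+\sum_{j\in\Gamma}L_{\{j\}}$$ for some vertex cover $\Gamma\subseteq\{1,\dots,n\}$ of $\Delta$, i.e. a set that meets every edge. -/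

import Mathlib

namespace MarginTable

noncomputable section

/-- The margin over `J` of an `n`-dimensional table `B` of size `a 0 × ⋯ × a (n-1)`: the entry at `i`
is the sum of all entries of `B` whose `j`-th index is `i j` for every `j ∈ J`. -/
def margin {n : ℕ} {a : Fin n → ℕ} {R : Type*} [AddCommMonoid R]
    (B : (∀ j, Fin (a j)) → R) (J : Finset (Fin n)) (i : ∀ j : J, Fin (a j)) : R :=
  ∑ k : (∀ j, Fin (a j)) with ∀ j : J, k j = i j, B k

/-- The ideal generated by the generalized `2 × 2` minors (exchanges of one coordinate) of a
multi-way table. -/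
def segreIdeal {ι : Type*} [DecidableEq ι] {c : ι → ℕ} {R : Type*} [CommRing R]
    (B : (∀ j, Fin (c j)) → R) : Ideal R :=
  Ideal.span {f | ∃ (p q : ∀ j, Fin (c j)) (l : ι),
    f = Matrix.det !![B p, B (Function.update q l (p l));
                      B (Function.update p l (q l)), B q]}

/-- The coordinate ring `𝕂[x_{i₁,…,iₙ}]` of tables. -/
abbrev TableRing (K : Type*) [CommSemiring K] {n : ℕ} (a : Fin n → ℕ) : Type _ :=
  MvPolynomial (∀ j, Fin (a j)) K

/-- The generic table `A = (x_{i₁,…,iₙ})`. -/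
def genericTable (K : Type*) [CommSemiring K] {n : ℕ} (a : Fin n → ℕ) :
    (∀ j, Fin (a j)) → TableRing K a :=
  fun i => MvPolynomial.X i

/-- `I_Δ`: the sum over `J ∈ Δ` of the ideals of generalized `2 × 2` minors of the margins `A_J`. -/
def independenceIdeal (K : Type*) [Field K] {n : ℕ} (a : Fin n → ℕ) (Δ : Set (Finset (Fin n))) :
    Ideal (TableRing K a) :=
  ⨆ J ∈ Δ, segreIdeal (c := fun j : J => a j) (margin (genericTable K a) J)

/-- `L_J`: the ideal generated by the entries of the margin `A_J`. -/
def marginIdeal (K : Type*) [Field K] {n : ℕ} (a : Fin n → ℕ) (J : Finset (Fin n)) :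
    Ideal (TableRing K a) :=
  Ideal.span (Set.range (margin (genericTable K a) J))

/-- `S_Δ`: the polynomial ring with one formal variable for each entry of each margin `A_J`,
`J ∈ Δ`. -/
abbrev MarginRing (K : Type*) [CommSemiring K] {n : ℕ} (a : Fin n → ℕ)
    (Δ : Set (Finset (Fin n))) : Type _ :=
  MvPolynomial (Σ J : Δ, ∀ j : J.1, Fin (a j)) K

/-- `τ_Δ : S_Δ → R` sends each formal variable to the corresponding margin entry. -/
def tau (K : Type*) [Field K] {n : ℕ} (a : Fin n → ℕ) (Δ : Set (Finset (Fin n))) :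
    MarginRing K a Δ →ₐ[K] TableRing K a :=
  MvPolynomial.aeval fun v => margin (genericTable K a) v.1.1 v.2

/-- The Segre parametrization `x_{i₁,…,iₙ} ↦ ∏ⱼ y_{j,iⱼ}`. -/
def segreMap (K : Type*) [Field K] {n : ℕ} (a : Fin n → ℕ) :
    TableRing K a →ₐ[K] MvPolynomial (Σ j : Fin n, Fin (a j)) K :=
  MvPolynomial.aeval fun i => ∏ j, MvPolynomial.X ⟨j, i j⟩

/-- `σ_Δ : S_Δ → 𝕂[y]`, the composite of `τ_Δ` and the Segre parametrization. -/
def sigma (K : Type*) [Field K] {n : ℕ} (a : Fin n → ℕ) (Δ : Set (Finset (Fin n))) :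
    MarginRing K a Δ →ₐ[K] MvPolynomial (Σ j : Fin n, Fin (a j)) K :=
  (segreMap K a).comp (tau K a Δ)

/-- `P_Δ`: the kernel of `σ_Δ`, regarded as an ideal of the table ring by substituting the margin
entries for the formal variables, that is, by extension along `τ_Δ`. -/
def mainPrime (K : Type*) [Field K] {n : ℕ} (a : Fin n → ℕ) (Δ : Set (Finset (Fin n))) :
    Ideal (TableRing K a) :=
  (RingHom.ker (sigma K a Δ)).map (tau K a Δ)

/-- `F` is a facet (a maximal face) of `Δ`. -/
def IsFacet {n : ℕ} (Δ : Set (Finset (Fin n))) (F : Finset (Fin n)) : Prop :=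
  Maximal (· ∈ Δ) F

/-- `Δ` is a simplicial complex each of whose facets has two elements. -/
structure IsGraph {n : ℕ} (Δ : Set (Finset (Fin n))) : Prop where
  down_closed : ∀ J ∈ Δ, ∀ J' ⊆ J, J' ∈ Δ
  card_facet : ∀ F, IsFacet Δ F → F.card = 2

/-- `Δ(j)`: the faces of `Δ` that contain `j`. -/
def facesAt {n : ℕ} (Δ : Set (Finset (Fin n))) (j : Fin n) : Set (Finset (Fin n)) :=
  {J | J ∈ Δ ∧ j ∈ J}

/-- `Γ` meets every facet (edge) of `Δ`. -/
def IsVertexCover {n : ℕ} (Δ : Set (Finset (Fin n))) (Γ : Finset (Fin n)) : Prop :=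
  ∀ F, IsFacet Δ F → ∃ j ∈ F, j ∈ Γ

end

end MarginTable

/-!
Fix a base index `o` and let the support of an index `k` be the set of coordinates in which `k`
differs from `o`. The margin entries `z_k = A_{supp k}(k)` form another system of linear coordinates
on the space of tables, and the margin `A_J` depends only on the `z_k` with `supp k ⊆ J`. If `Δ` is
closed under subsets, then `S_Δ → R` becomes, modulo relations in `ker σ_Δ`, the inclusion of the
polynomial ring in the `z_k` with `supp k ∈ Δ`, so `P_Δ` is the extension of a prime ideal to a
polynomial ring and hence prime.

Let `Δ` be a graph and `𝔞` a minimal prime of `I_Δ`. Over the residue field of `𝔞` a table whose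
total is nonzero has the same margins on `Δ` as a table of rank one. So if `P_Δ ⊄ 𝔞`, then the total
lies in `𝔞`; as `A_{jl} · A_∅ = A_j A_l` modulo `I_Δ` for each edge `{j, l}`, the vertices `j` with
`L_{j} ⊆ 𝔞` form a vertex cover `Γ`, and similarly `P_{Δ(j)} ⊆ 𝔞` for `j ∉ Γ`. Hence `𝔞` contains
the ideal `Q` attached to `Γ`. Although `Q` is not obviously prime, there is a toric prime ideal
between `I_Δ` and `Q`: in the coordinates `z_k`, its generators say that some `z_k` vanish and that
the others are arranged in matrices of rank one. By minimality `𝔞` is that prime ideal and equals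
`Q`.
-/

namespace MarginTable

open MvPolynomial Finset

section Toric

theorem prod_map_eq_of_exchange {V ρ κ B : Type*} [CommMonoid B] {row : V → ρ} {col : V → κ}
    {f : V → B} (hinj : ∀ v w, row v = row w → col v = col w → v = w)
    (hf : ∀ v w x, row v = row x → col w = col x →
      ∃ y, row y = row w ∧ col y = col v ∧ f v * f w = f x * f y)
    {M M' : Multiset V} (hrow : M.map row = M'.map row) (hcol : M.map col = M'.map col) :
    (M.map f).prod = (M'.map f).prod := by
  induction M' using Multiset.induction_on generalizing M with
  | empty => rw [Multiset.map_eq_zero.1 hrow]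
  | cons x M' ih =>
    obtain ⟨v, hvM, hv⟩ : ∃ v ∈ M, row v = row x := by
      rw [← Multiset.mem_map, hrow]; simp
    obtain ⟨w, hwM, hw⟩ : ∃ w ∈ M, col w = col x := by
      rw [← Multiset.mem_map, hcol]; simp
    obtain ⟨M₁, rfl⟩ := Multiset.exists_cons_of_mem hvM
    rcases Multiset.mem_cons.1 hwM with rfl | hwM
    · obtain rfl := hinj _ _ hv hw
      simp only [Multiset.map_cons, Multiset.cons_inj_right, Multiset.prod_cons] at hrow hcol ⊢
      rw [ih hrow hcol]
    · obtain ⟨M₂, rfl⟩ := Multiset.exists_cons_of_mem hwM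
      obtain ⟨y, hyr, hyc, hy⟩ := hf v w x hv hw
      simp only [Multiset.map_cons, Multiset.prod_cons] at hrow hcol ⊢
      rw [hv, Multiset.cons_inj_right, ← hyr] at hrow
      rw [hw, Multiset.cons_swap, Multiset.cons_inj_right, ← hyc] at hcol
      rw [← ih (M := y ::ₘ M₂) (by simpa using hrow) (by simpa using hcol), Multiset.map_cons,
        Multiset.prod_cons, ← mul_assoc, ← mul_assoc, hy]

theorem disjSum_inj {α β : Type*} {M M' : Multiset α} {N N' : Multiset β} :
    M.disjSum N = M'.disjSum N' ↔ M = M' ∧ N = N' := by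
  classical
  refine ⟨fun h => ⟨?_, ?_⟩, fun h => by rw [h.1, h.2]⟩ <;> ext x
  · simpa [Multiset.disjSum, Multiset.count_map_eq_count' _ _ Sum.inl_injective] using
      congr_arg (Multiset.count (Sum.inl x)) h
  · simpa [Multiset.disjSum, Multiset.count_map_eq_count' _ _ Sum.inr_injective] using
      congr_arg (Multiset.count (Sum.inr x)) h

variable {K V σ B : Type*}

theorem aeval_monomial_one [CommSemiring K] [CommSemiring B] [Algebra K B] (f : V → B)
    (m : V →₀ ℕ) : aeval f (monomial m (1 : K)) = (m.toMultiset.map f).prod := by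
  rw [aeval_monomial, map_one, one_mul, Finsupp.toMultiset_map, Finsupp.prod_toMultiset,
    Finsupp.prod_mapDomain_index (by simp) (by simp [pow_add])]

theorem prod_map_monomial_one [CommSemiring K] (μ : V → σ →₀ ℕ) (M : Multiset V) :
    (M.map fun v => monomial (μ v) (1 : K)).prod = monomial (M.map μ).sum 1 := by
  induction M using Multiset.induction_on with
  | empty => simp
  | cons v M ih => simp [ih, monomial_mul]

variable [CommSemiring K] [CommSemiring B] [Algebra K B] {f : V → B} {s : Set V}

theorem ker_aeval_indicator_monomial_le {μ : V → σ →₀ ℕ} (hs : ∀ v ∉ s, f v = 0)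
    (hf : Function.FactorsThrough (fun M => (M.map f).prod) fun M : Multiset V => (M.map μ).sum) :
    RingHom.ker (aeval (R := K) (s.indicator fun v => monomial (μ v) (1 : K))) ≤
      RingHom.ker (aeval (R := K) f) := by
  let ψ : MvPolynomial σ K →ₗ[K] B := (basisMonomials σ K).constr K
    (Function.extend (fun M : Multiset V => (M.map μ).sum) (fun M => (M.map f).prod) 0)
  have hψ : ∀ M : Multiset V, ψ (monomial (M.map μ).sum 1) = (M.map f).prod := fun M => by
    rw [← hf.extend_apply 0 M]
    exact (basisMonomials σ K).constr_basis K _ _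
  have hcomp : ψ ∘ₗ (aeval (s.indicator fun v => monomial (μ v) (1 : K))).toLinearMap =
      (aeval (R := K) f).toLinearMap := by
    refine (basisMonomials V K).ext fun m => ?_
    simp only [coe_basisMonomials, LinearMap.comp_apply, AlgHom.toLinearMap_apply,
      aeval_monomial_one]
    by_cases hm : ∀ v ∈ m.toMultiset, v ∈ s
    · rw [Multiset.map_congr rfl fun v hv => Set.indicator_of_mem (hm v hv) _,
        prod_map_monomial_one, hψ]
    · push Not at hm
      obtain ⟨v, hvm, hvs⟩ := hm
      rw [Multiset.prod_eq_zero (Multiset.mem_map.2 ⟨v, hvm, Set.indicator_of_notMem hvs _⟩),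
        Multiset.prod_eq_zero (Multiset.mem_map.2 ⟨v, hvm, hs v hvs⟩), map_zero]
  intro p hp
  rw [RingHom.mem_ker] at hp ⊢
  rw [← AlgHom.toLinearMap_apply, ← hcomp, LinearMap.comp_apply, AlgHom.toLinearMap_apply, hp,
    map_zero]

theorem ker_aeval_indicator_mul_le {ρ κ : Type*} {row : V → ρ} {col : V → κ}
    (hinj : ∀ v w, row v = row w → col v = col w → v = w)
    (hs : ∀ v ∉ s, f v = 0)
    (hf : ∀ v w x, row v = row x → col w = col x →
      ∃ y, row y = row w ∧ col y = col v ∧ f v * f w = f x * f y) :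
    RingHom.ker (aeval (R := K) (s.indicator fun v =>
      (X (Sum.inl (row v)) * X (Sum.inr (col v)) : MvPolynomial (ρ ⊕ κ) K))) ≤
      RingHom.ker (aeval (R := K) f) := by
  classical
  let μ : V → ρ ⊕ κ →₀ ℕ := fun v => .single (.inl (row v)) 1 + .single (.inr (col v)) 1
  have hμ : (fun v => X (Sum.inl (row v)) * X (Sum.inr (col v))) =
      fun v => monomial (μ v) (1 : K) := funext fun v => by simp [X, μ, monomial_mul]
  rw [hμ]
  refine ker_aeval_indicator_monomial_le hs fun M M' h => ?_
  have htoMultiset : ∀ M : Multiset V, Finsupp.toMultiset (M.map μ).sum =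
      (M.map row).disjSum (M.map col) := fun M => by
    induction M using Multiset.induction_on with
    | empty => simp
    | cons v M ih =>
      rw [Multiset.map_cons, Multiset.sum_cons, map_add, ih]
      simpa [μ, Multiset.disjSum, Multiset.add_cons] using Multiset.cons_swap ..
  have hM := congr_arg Finsupp.toMultiset h
  simp only [htoMultiset] at hM
  exact prod_map_eq_of_exchange hinj hf (disjSum_inj.1 hM).1 (disjSum_inj.1 hM).2

end Toric

section Segre

/-- The relations satisfied by the entries of a table of rank one: the product of two entries does
not change when their indices exchange one coordinate. -/
def IsSegre {ι : Type*} [DecidableEq ι] {X : ι → Type*} {B : Type*} [Mul B]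
    (T : (∀ j, X j) → B) : Prop :=
  ∀ (l : ι) (v w : ∀ j, X j),
    T v * T w = T (Function.update w l (v l)) * T (Function.update v l (w l))

theorem isSegre_prod {ι : Type*} [Fintype ι] [DecidableEq ι] {X : ι → Type*} {B : Type*}
    [CommMonoid B] (γ : ∀ j, X j → B) : IsSegre fun k : ∀ j, X j => ∏ j, γ j (k j) := by
  intro l v w
  simp only [← prod_mul_distrib]
  refine prod_congr rfl fun j _ => ?_
  rcases eq_or_ne j l with rfl | hj
  · simp
  · simp [Function.update_of_ne hj, mul_comm]

theorem segreIdeal_le_ker_iff {ι : Type*} [DecidableEq ι] {c : ι → ℕ} {R S : Type*} [CommRing R]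
    [CommRing S] (f : R →+* S) (T : (∀ j, Fin (c j)) → R) :
    segreIdeal T ≤ RingHom.ker f ↔ IsSegre (f ∘ T) := by
  rw [segreIdeal, Ideal.span_le]
  constructor
  · intro h l v w
    have := h ⟨v, w, l, rfl⟩
    simpa [Matrix.det_fin_two_of, RingHom.mem_ker, sub_eq_zero] using this
  · rintro h _ ⟨v, w, l, rfl⟩
    simpa [Matrix.det_fin_two_of, RingHom.mem_ker, sub_eq_zero] using h l v w

end Segre

section Margin

variable {n : ℕ} {a : Fin n → ℕ} {B : Type*}

section AddCommMonoid

variable [AddCommMonoid B] {T : (∀ j, Fin (a j)) → B} {J : Finset (Fin n)} {k k' : ∀ j, Fin (a j)}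

/-- The entry of the margin over `J` at the restriction of `k` to `J`. Indexing the margins by
indices `k` of the whole table makes the margins over different `J` comparable. -/
def marginAt (T : (∀ j, Fin (a j)) → B) (J : Finset (Fin n)) (k : ∀ j, Fin (a j)) : B :=
  margin T J (J.restrict k)

theorem marginAt_eq_sum (T : (∀ j, Fin (a j)) → B) (J : Finset (Fin n)) (k : ∀ j, Fin (a j)) :
    marginAt T J k = ∑ k' with ∀ j ∈ J, k' j = k j, T k' := by
  simp [marginAt, margin]

theorem marginAt_congr (h : ∀ j ∈ J, k j = k' j) : marginAt T J k = marginAt T J k' :=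
  congr_arg (margin T J) (funext fun j => h j j.2)

theorem marginAt_update_of_notMem {l : Fin n} (hl : l ∉ J) (x : Fin (a l)) :
    marginAt T J (Function.update k l x) = marginAt T J k :=
  marginAt_congr fun _ hj => Function.update_of_ne (ne_of_mem_of_not_mem hj hl) _ _

theorem marginAt_univ (T : (∀ j, Fin (a j)) → B) (k : ∀ j, Fin (a j)) :
    marginAt T univ k = T k := by
  simp [marginAt_eq_sum, ← funext_iff, filter_eq']

theorem sum_marginAt_update {j : Fin n} (hj : j ∉ J) (k : ∀ j, Fin (a j)) :
    ∑ i, marginAt T (insert j J) (Function.update k j i) = marginAt T J k := by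
  rw [marginAt_eq_sum, ← sum_fiberwise _ (fun k' : ∀ j, Fin (a j) => k' j)]
  refine sum_congr rfl fun i _ => ?_
  rw [marginAt_eq_sum, filter_filter]
  refine sum_congr (filter_congr fun k' _ => ?_) fun _ _ => rfl
  rw [forall_mem_insert, Function.update_self, and_comm]
  refine and_congr_left fun _ => forall₂_congr fun l hl => ?_
  rw [Function.update_of_ne (ne_of_mem_of_not_mem hl hj)]

theorem map_margin {B' G : Type*} [AddCommMonoid B'] [FunLike G B B'] [AddMonoidHomClass G B B']
    (f : G) (T : (∀ j, Fin (a j)) → B) (J : Finset (Fin n)) (i : ∀ j : J, Fin (a j)) :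
    f (margin T J i) = margin (f ∘ T) J i :=
  map_sum f _ _

theorem map_marginAt {B' G : Type*} [AddCommMonoid B'] [FunLike G B B'] [AddMonoidHomClass G B B']
    (f : G) (T : (∀ j, Fin (a j)) → B) (J : Finset (Fin n)) (k : ∀ j, Fin (a j)) :
    f (marginAt T J k) = marginAt (f ∘ T) J k :=
  map_margin f T J _

theorem restrict_surjective (o : ∀ j, Fin (a j)) (J : Finset (Fin n)) :
    Function.Surjective (J.restrict (π := fun j => Fin (a j))) := fun i =>
  ⟨Function.updateFinset o J i, Function.restrict_updateFinset o i⟩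

end AddCommMonoid

theorem marginAt_prod [CommSemiring B] (η : ∀ j, Fin (a j) → B) (J : Finset (Fin n))
    (k : ∀ j, Fin (a j)) :
    marginAt (fun k => ∏ j, η j (k j)) J k =
      ∏ j, if j ∈ J then η j (k j) else ∑ i, η j i := by
  have hfactor : ∀ j, (if j ∈ J then η j (k j) else ∑ i, η j i) =
      ∑ i ∈ if j ∈ J then {k j} else univ, η j i := fun j => by split_ifs <;> simp
  simp only [hfactor, prod_univ_sum, marginAt_eq_sum]
  refine sum_congr (ext fun k' => ?_) fun _ _ => rfl
  simp only [mem_filter_univ, Fintype.mem_piFinset]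
  refine forall_congr' fun j => ?_
  split_ifs with hj <;> simp [hj]

theorem isSegre_margin_iff [CommSemiring B] (o : ∀ j, Fin (a j)) {T : (∀ j, Fin (a j)) → B}
    {J : Finset (Fin n)} : IsSegre (margin T J) ↔ IsSegre (marginAt T J) := by
  have hupdate : ∀ (l : J) (k : ∀ j, Fin (a j)) (x : Fin (a l)),
      Function.update (J.restrict k) l x = J.restrict (Function.update k l x) := fun l k x => by
    ext j
    rcases eq_or_ne j l with rfl | hj
    · simp
    · simp [hj, Subtype.coe_ne_coe.2 hj]
  constructor
  · intro h l v w
    by_cases hl : l ∈ J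
    · have := h ⟨l, hl⟩ (J.restrict v) (J.restrict w)
      rwa [hupdate, hupdate] at this
    · rw [marginAt_update_of_notMem hl, marginAt_update_of_notMem hl, mul_comm]
  · intro h l v w
    obtain ⟨v, rfl⟩ := restrict_surjective o J v
    obtain ⟨w, rfl⟩ := restrict_surjective o J w
    rw [hupdate, hupdate]
    exact h l v w

theorem isSegre_marginAt_of_card_le_one [CommSemiring B] {T : (∀ j, Fin (a j)) → B}
    {J : Finset (Fin n)} (hJ : #J ≤ 1) : IsSegre (marginAt T J) := by
  intro l v w
  by_cases hl : l ∈ J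
  · have hlJ : ∀ v w : ∀ j, Fin (a j),
        marginAt T J (Function.update w l (v l)) = marginAt T J v := fun v w =>
      marginAt_congr fun j hj => by
        obtain rfl := card_le_one.1 hJ j hj l hl
        simp
    rw [hlJ, hlJ]
  · rw [marginAt_update_of_notMem hl, marginAt_update_of_notMem hl, mul_comm]

theorem aeval_comp_genericTable {K : Type*} [CommSemiring K] [CommSemiring B] [Algebra K B]
    (T : (∀ j, Fin (a j)) → B) :
    aeval (R := K) T ∘ genericTable K a = T :=
  funext fun k => aeval_X T k

end Margin

section Ideals

variable {K : Type*} [Field K] {n : ℕ} {a : Fin n → ℕ} {Δ : Set (Finset (Fin n))}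
  {J : Finset (Fin n)} {B : Type*} [CommRing B]

theorem independenceIdeal_le_ker_iff (o : ∀ j, Fin (a j)) (f : TableRing K a →+* B) :
    independenceIdeal K a Δ ≤ RingHom.ker f ↔
      ∀ J ∈ Δ, IsSegre (marginAt (f ∘ genericTable K a) J) := by
  simp only [independenceIdeal, iSup_le_iff, segreIdeal_le_ker_iff, ← isSegre_margin_iff o]
  simp only [Function.comp_def, map_margin]

theorem marginIdeal_le_iff (o : ∀ j, Fin (a j)) (I : Ideal (TableRing K a)) :
    marginIdeal K a J ≤ I ↔ ∀ k, marginAt (genericTable K a) J k ∈ I := by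
  rw [marginIdeal, Ideal.span_le, Set.range_subset_iff, (restrict_surjective o J).forall]
  rfl

end Ideals

section SupportMargin

variable {n : ℕ} {a : Fin n → ℕ} {B : Type*} {o : ∀ j, Fin (a j)} {J : Finset (Fin n)}

/-- The coordinates in which `k` differs from the base index `o`. -/
def indexSupport (o k : ∀ j, Fin (a j)) : Finset (Fin n) :=
  {j | k j ≠ o j}

theorem mem_indexSupport {k : ∀ j, Fin (a j)} {j : Fin n} :
    j ∈ indexSupport o k ↔ k j ≠ o j := by
  simp [indexSupport]

theorem indexSupport_subset_iff {k : ∀ j, Fin (a j)} :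
    indexSupport o k ⊆ J ↔ ∀ j ∉ J, k j = o j := by
  simp only [subset_iff, mem_indexSupport, not_imp_comm]

theorem sdiff_indexSupport_update_ssubset {k : ∀ j, Fin (a j)} {j : Fin n} {i : Fin (a j)}
    (hj : j ∈ J) (hk : k j = o j) (hi : i ≠ o j) :
    J \ indexSupport o (Function.update k j i) ⊂ J \ indexSupport o k := by
  refine ssubset_iff_of_subset (fun l hl => ?_) |>.2 ⟨j, by simp [mem_indexSupport, hj, hk], ?_⟩
  · have hlj : l ≠ j := by rintro rfl; simp [mem_indexSupport, hi] at hl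
    simpa [mem_indexSupport, hlj] using hl
  · simp [mem_indexSupport, hi]

section AddCommMonoid

variable [AddCommMonoid B]

/-- The entry of the margin over `indexSupport o k` at `k`. The margins over all sets of indices
are determined by these entries, which can be prescribed freely, so that
`supportMargin o (genericTable K a)` is another system of coordinates on the space of tables. -/
def supportMargin (o : ∀ j, Fin (a j)) (T : (∀ j, Fin (a j)) → B) (k : ∀ j, Fin (a j)) : B :=
  marginAt T (indexSupport o k) k

theorem map_supportMargin {B' G : Type*} [AddCommMonoid B'] [FunLike G B B']
    [AddMonoidHomClass G B B'] (f : G) (T : (∀ j, Fin (a j)) → B) (k : ∀ j, Fin (a j)) :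
    f (supportMargin o T k) = supportMargin o (f ∘ T) k :=
  map_marginAt f T _ k

end AddCommMonoid

section AddCommGroup

variable [AddCommGroup B] {T T' : (∀ j, Fin (a j)) → B}

theorem marginAt_mem_of_supportMargin_mem {S : Type*} [SetLike S B] [AddSubgroupClass S B] {G : S}
    (h : ∀ k, indexSupport o k ⊆ J → supportMargin o T k ∈ G) (k : ∀ j, Fin (a j)) :
    marginAt T J k ∈ G := by
  induction hN : J \ indexSupport o k using Finset.strongInduction generalizing J k with
  | H N ih =>
  subst hN
  rcases (J \ indexSupport o k).eq_empty_or_nonempty with hJk | ⟨j, hj⟩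
  · have hJk : J ⊆ indexSupport o k := sdiff_eq_empty_iff_subset.1 hJk
    have hsupp : indexSupport o (J.piecewise k o) = J := by
      ext l
      by_cases hl : l ∈ J
      · simpa [mem_indexSupport, hl] using mem_indexSupport.1 (hJk hl)
      · simp [mem_indexSupport, hl]
    have hk : marginAt T J k = supportMargin o T (J.piecewise k o) := by
      rw [supportMargin, hsupp]
      exact marginAt_congr fun l hl => (J.piecewise_eq_of_mem _ _ hl).symm
    exact hk ▸ h _ hsupp.subset
  obtain ⟨hjJ, hjk⟩ : j ∈ J ∧ k j = o j := by simpa [mem_indexSupport] using hj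
  have hsum := sum_marginAt_update (T := T) (notMem_erase j J) k
  rw [insert_erase hjJ, ← add_sum_erase _ _ (mem_univ (o j)), ← hjk,
    Function.update_eq_self, ← eq_sub_iff_add_eq] at hsum
  rw [hsum]
  refine sub_mem (ih _ ?_ (fun k hk => h k (hk.trans (erase_subset _ _))) k rfl)
    (sum_mem fun i hi => ih _ ?_ h _ rfl)
  · rw [erase_sdiff_comm]
    exact erase_ssubset hj
  · exact sdiff_indexSupport_update_ssubset hjJ hjk (hjk ▸ ne_of_mem_erase hi)

theorem marginAt_eq_of_supportMargin_eq
    (h : ∀ k, indexSupport o k ⊆ J → supportMargin o T k = supportMargin o T' k)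
    (k : ∀ j, Fin (a j)) : marginAt T J k = marginAt T' J k := by
  have hsub : ∀ J k, marginAt (T - T') J k = marginAt T J k - marginAt T' J k := fun J k => by
    simp [marginAt_eq_sum]
  rw [← sub_eq_zero, ← hsub, ← AddSubgroup.mem_bot]
  refine marginAt_mem_of_supportMargin_mem (o := o) (fun k hk => ?_) k
  rw [AddSubgroup.mem_bot, supportMargin, hsub, sub_eq_zero]
  exact h k hk

end AddCommGroup

theorem exists_supportMargin_eq [AddCommGroup B] (o : ∀ j, Fin (a j))
    (g : (∀ j, Fin (a j)) → B) : ∃ T : (∀ j, Fin (a j)) → B, supportMargin o T = g := by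
  let e : (∀ j, Fin (a j)) → (∀ j, Fin (a j)) → ℤ := fun k => Pi.single k 1
  have hspan : ⊤ ≤ Submodule.span ℤ (Set.range (supportMargin o e)) := by
    rw [← (Pi.basisFun ℤ _).span_eq, Submodule.span_le, Set.range_subset_iff]
    intro k
    rw [Pi.basisFun_apply, SetLike.mem_coe, ← marginAt_univ (fun k => Pi.single k (1 : ℤ)) k]
    exact marginAt_mem_of_supportMargin_mem
      (fun k _ => Submodule.subset_span (Set.mem_range_self k)) k
  have hli : LinearIndependent ℤ (supportMargin o e) :=
    linearIndependent_iff_injective_fintypeLinearCombination.2 <|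
      OrzechProperty.injective_of_surjective_endomorphism _ <| LinearMap.range_eq_top.1 <|
        (Fintype.range_linearCombination ℤ _).trans (top_le_iff.1 hspan)
  let b := Module.Basis.mk hli hspan
  refine ⟨b.constr ℤ g ∘ e, funext fun k => ?_⟩
  rw [← map_supportMargin, ← b.constr_basis ℤ g k, Module.Basis.mk_apply]

theorem aeval_supportMargin_genericTable_surjective (K : Type*) [CommRing K] (o : ∀ j, Fin (a j)) :
    Function.Surjective (aeval (R := K) (supportMargin o (genericTable K a))) := by
  rw [← AlgHom.range_eq_top, eq_top_iff, ← adjoin_range_X, Algebra.adjoin_le_iff,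
    Set.range_subset_iff]
  intro k
  rw [SetLike.mem_coe, ← marginAt_univ X k]
  exact marginAt_mem_of_supportMargin_mem (o := o)
    (fun k _ => AlgHom.mem_range _ |>.2 ⟨X k, aeval_X _ k⟩) k

theorem isSegre_marginAt_of_supportMargin_eq_prod [CommRing B] {T : (∀ j, Fin (a j)) → B}
    (α : ∀ j, Fin (a j) → B)
    (h : ∀ k, indexSupport o k ⊆ J → supportMargin o T k = ∏ j, α j (k j)) :
    IsSegre (marginAt T J) := by
  let η : ∀ j, Fin (a j) → B := fun j =>
    Function.update (α j) (o j) (α j (o j) - ∑ i ∈ univ.erase (o j), α j i)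
  have hη : ∀ j, ∑ i, η j i = α j (o j) := fun j => by
    rw [← add_sum_erase _ _ (mem_univ (o j)), sum_congr rfl fun i hi =>
      Function.update_of_ne (ne_of_mem_erase hi) _ _]
    simp [η]
  have hsupp : ∀ k, supportMargin o (fun k => ∏ j, η j (k j)) k = ∏ j, α j (k j) := fun k => by
    rw [supportMargin, marginAt_prod]
    refine prod_congr rfl fun j _ => ?_
    split_ifs with hj
    · exact Function.update_of_ne (mem_indexSupport.1 hj) _ _
    · rw [hη, not_not.1 (mt mem_indexSupport.2 hj)]
  have hT : marginAt T J = fun k => ∏ j, if j ∈ J then η j (k j) else ∑ i, η j i := by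
    ext k
    rw [marginAt_eq_of_supportMargin_eq fun k hk => (h k hk).trans (hsupp k).symm, marginAt_prod]
  rw [hT]
  exact isSegre_prod fun j i => if j ∈ J then η j i else ∑ i, η j i

end SupportMargin

theorem isPrime_map_ker {K S R D U : Type*} [CommRing K] [CommRing S] [CommRing R] [CommRing D]
    [IsDomain D] [Algebra K S] [Algebra K R] [Algebra K D] {φ : S →ₐ[K] R} {s : S →ₐ[K] D}
    {g : U → R}
    (hg : Function.Surjective (aevalTower φ g)) {ψ : R →ₐ[K] MvPolynomial U D}
    (hψ : ψ.comp φ = (IsScalarTower.toAlgHom K D (MvPolynomial U D)).comp s)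
    (hψg : ∀ u, ψ (g u) = X u) : ((RingHom.ker s).map φ).IsPrime := by
  have hcomp : ψ.comp (aevalTower φ g) = mapAlgHom s :=
    algHom_ext' (AlgHom.ext fun x => by simpa using DFunLike.congr_fun hψ x) fun u => by simp [hψg]
  have hker : RingHom.ker (aevalTower φ g) ≤ (RingHom.ker s).map C := by
    rw [← ker_mapAlgHom, ← hcomp]
    intro q hq
    rw [RingHom.mem_ker] at hq ⊢
    rw [AlgHom.comp_apply, hq, map_zero]
  have : ((RingHom.ker s).map (C (σ := U))).IsPrime :=
    ker_mapAlgHom (σ := U) s ▸ RingHom.ker_isPrime _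
  have hmap : (RingHom.ker s).map φ = ((RingHom.ker s).map C).map (aevalTower φ g) := by
    refine .trans ?_ (Ideal.map_map C (aevalTower φ g : MvPolynomial U S →+* R)).symm
    rw [aevalTower_comp_C]
    rfl
  exact hmap ▸ Ideal.map_isPrime_of_surjective hg hker

section MainPrime

variable {K : Type*} [Field K] {n : ℕ} {a : Fin n → ℕ} {Δ : Set (Finset (Fin n))}

theorem tau_X (v : Σ J : Δ, ∀ j : J.1, Fin (a j)) :
    tau K a Δ (X v) = margin (genericTable K a) v.1 v.2 :=
  aeval_X _ v

theorem segreMap_comp_genericTable :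
    segreMap K a ∘ genericTable K a = fun k => ∏ j, X ⟨j, k j⟩ :=
  aeval_comp_genericTable _

theorem segreMap_marginAt (J : Finset (Fin n)) (k : ∀ j, Fin (a j)) :
    segreMap K a (marginAt (genericTable K a) J k) =
      ∏ j, if j ∈ J then X ⟨j, k j⟩ else ∑ i, X ⟨j, i⟩ := by
  rw [map_marginAt, segreMap_comp_genericTable]
  exact marginAt_prod
    (fun j i => (X ⟨j, i⟩ : MvPolynomial (Σ j : Fin n, Fin (a j)) K)) J k

theorem mainPrime_le_ker_segreMap : mainPrime K a Δ ≤ RingHom.ker (segreMap K a) :=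
  Ideal.map_le_iff_le_comap.2 fun _ hs => hs

theorem mainPrime_le_ker {B : Type*} [CommRing B] [Algebra K B] {f : TableRing K a →ₐ[K] B}
    {η : ∀ j, Fin (a j) → B}
    (h : ∀ J ∈ Δ, margin (f ∘ genericTable K a) J = margin (fun k => ∏ j, η j (k j)) J) :
    mainPrime K a Δ ≤ RingHom.ker f := by
  have hcomp : f.comp (tau K a Δ) =
      (aeval fun v : Σ j : Fin n, Fin (a j) => η v.1 v.2).comp (sigma K a Δ) := by
    refine algHom_ext fun v => ?_
    rw [AlgHom.comp_apply, AlgHom.comp_apply, sigma, AlgHom.comp_apply, tau_X, map_margin,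
      map_margin, map_margin, h _ v.1.2, segreMap_comp_genericTable]
    congr 1 with k
    simp
  refine Ideal.map_le_iff_le_comap.2 fun s hs => ?_
  rw [RingHom.mem_ker] at hs
  rw [Ideal.mem_comap, RingHom.mem_ker, ← AlgHom.comp_apply, hcomp, AlgHom.comp_apply, hs,
    map_zero]

theorem mul_sub_mul_mem_mainPrime {S T : Finset (Fin n)} (hS : S ∈ Δ) (hT : T ∈ Δ) {l : Fin n}
    (hl : l ∈ S ↔ l ∈ T) (v w : ∀ j, Fin (a j)) :
    marginAt (genericTable K a) S v * marginAt (genericTable K a) T w -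
      marginAt (genericTable K a) T (Function.update w l (v l)) *
        marginAt (genericTable K a) S (Function.update v l (w l)) ∈ mainPrime K a Δ := by
  let Y (J : Δ) (k : ∀ j, Fin (a j)) : MarginRing K a Δ := X ⟨J, J.1.restrict k⟩
  have htau : ∀ J k, tau K a Δ (Y J k) = marginAt (genericTable K a) J.1 k := fun J k =>
    tau_X _
  have hker : Y ⟨S, hS⟩ v * Y ⟨T, hT⟩ w -
      Y ⟨T, hT⟩ (Function.update w l (v l)) * Y ⟨S, hS⟩ (Function.update v l (w l)) ∈
        RingHom.ker (sigma K a Δ) := by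
    simp only [RingHom.mem_ker, sigma, AlgHom.comp_apply, map_sub, map_mul, htau,
      segreMap_marginAt, ← prod_mul_distrib, sub_eq_zero]
    refine prod_congr rfl fun j _ => ?_
    rcases eq_or_ne j l with rfl | hj
    · simp only [Function.update_self, hl]
    · simp only [Function.update_of_ne hj, mul_comm]
  have hmem := Ideal.mem_map_of_mem (tau K a Δ) hker
  rwa [map_sub, map_mul, map_mul, htau, htau, htau, htau] at hmem

theorem independenceIdeal_le_mainPrime (o : ∀ j, Fin (a j)) :
    independenceIdeal K a Δ ≤ mainPrime K a Δ := by
  rw [← Ideal.mk_ker (I := mainPrime K a Δ), independenceIdeal_le_ker_iff o]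
  intro J hJ l v w
  simp only [← map_marginAt, ← map_mul]
  exact Ideal.Quotient.eq.2 (mul_sub_mul_mem_mainPrime hJ hJ Iff.rfl v w)

theorem aevalTower_tau_supportMargin_surjective (o : ∀ j, Fin (a j)) :
    Function.Surjective (aevalTower (tau K a Δ) fun k : {k // indexSupport o k ∉ Δ} =>
      supportMargin o (genericTable K a) k) := by
  rw [← AlgHom.range_eq_top, eq_top_iff, ← (AlgHom.range_eq_top _).2
    (aeval_supportMargin_genericTable_surjective K o), ← Algebra.adjoin_range_eq_range_aeval,
    Algebra.adjoin_le_iff, Set.range_subset_iff]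
  intro k
  by_cases hk : indexSupport o k ∈ Δ
  · exact ⟨C (X ⟨⟨_, hk⟩, Finset.restrict _ k⟩), (aevalTower_C _ _ _).trans (tau_X _)⟩
  · exact ⟨X ⟨k, hk⟩, aevalTower_X _ _ _⟩

theorem isPrime_mainPrime (hΔ : ∀ J ∈ Δ, ∀ J' ⊆ J, J' ∈ Δ) (o : ∀ j, Fin (a j)) :
    (mainPrime K a Δ).IsPrime := by
  classical
  let U := {k : ∀ j, Fin (a j) // indexSupport o k ∉ Δ}
  let D := MvPolynomial (Σ j : Fin n, Fin (a j)) K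
  obtain ⟨T, hT⟩ := exists_supportMargin_eq o fun k =>
    if hk : indexSupport o k ∈ Δ then
      IsScalarTower.toAlgHom K D (MvPolynomial U D)
        (segreMap K a (supportMargin o (genericTable K a) k))
    else X ⟨k, hk⟩
  refine isPrime_map_ker (aevalTower_tau_supportMargin_surjective o) (ψ := aeval T)
    (algHom_ext fun v => ?_) fun k => ?_
  · obtain ⟨⟨J, hJ⟩, i⟩ := v
    obtain ⟨k, rfl⟩ := restrict_surjective o J i
    rw [AlgHom.comp_apply, AlgHom.comp_apply, sigma, AlgHom.comp_apply, tau_X, map_margin,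
      map_margin, map_margin, aeval_comp_genericTable]
    refine marginAt_eq_of_supportMargin_eq (o := o) (fun k hk => ?_) k
    rw [hT]
    simp only [dif_pos (hΔ J hJ _ hk), map_supportMargin]
    rfl
  · rw [map_supportMargin, aeval_comp_genericTable, hT]
    exact dif_neg k.2

theorem eq_bot_of_isEmpty {σ : Type*} [IsEmpty σ]
    {I : Ideal (MvPolynomial σ K)} (hI : I ≠ ⊤) : I = ⊥ :=
  have := Ring.isField_iff_isSimpleOrder_ideal.1
    ((isEmptyRingEquiv K σ).toMulEquiv.isField (Field.toIsField K))
  (eq_bot_or_eq_top I).resolve_right hI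

end MainPrime

section FieldValued

variable {n : ℕ} {a : Fin n → ℕ} {Δ : Set (Finset (Fin n))} {j l : Fin n}

theorem margin_eq_iff {B : Type*} [AddCommMonoid B] (o : ∀ j, Fin (a j))
    {T T' : (∀ j, Fin (a j)) → B} {J : Finset (Fin n)} :
    margin T J = margin T' J ↔ ∀ k, marginAt T J k = marginAt T' J k := by
  rw [funext_iff, (restrict_surjective o J).forall]
  rfl

theorem exists_isFacet_superset {J : Finset (Fin n)} (hJ : J ∈ Δ) : ∃ F, IsFacet Δ F ∧ J ⊆ F :=
  have ⟨F, hJF, hF⟩ := (Set.toFinite Δ).exists_le_maximal hJ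
  ⟨F, hF, hJF⟩

theorem IsGraph.face_cases (hΔ : IsGraph Δ) {J : Finset (Fin n)} (hJ : J ∈ Δ) :
    J = ∅ ∨ (∃ j, J = {j}) ∨ ∃ j l, j ≠ l ∧ J = {j, l} := by
  obtain ⟨F, hF, hJF⟩ := exists_isFacet_superset hJ
  have hcard := card_le_card hJF
  rw [hΔ.card_facet F hF] at hcard
  interval_cases h : #J
  · exact .inl (card_eq_zero.1 h)
  · exact .inr (.inl (card_eq_one.1 h))
  · exact .inr (.inr (card_eq_two.1 h))

theorem IsGraph.face_cases_of_mem (hΔ : IsGraph Δ) {J : Finset (Fin n)} (hJ : J ∈ Δ)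
    (hj : j ∈ J) : J = {j} ∨ ∃ l, l ≠ j ∧ J = {j, l} := by
  rcases hΔ.face_cases hJ with rfl | ⟨i, rfl⟩ | ⟨i, l, hil, rfl⟩
  · simp at hj
  · exact .inl (by rw [mem_singleton.1 hj])
  · rcases mem_insert.1 hj with rfl | hj
    · exact .inr ⟨l, hil.symm, rfl⟩
    · obtain rfl := mem_singleton.1 hj
      exact .inr ⟨i, hil, pair_comm _ _⟩

section AddCommMonoid

variable {B : Type*} [AddCommMonoid B]

theorem marginAt_singleton_congr {T : (∀ j, Fin (a j)) → B} {k k' : ∀ j, Fin (a j)}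
    (h : k j = k' j) : marginAt T {j} k = marginAt T {j} k' :=
  marginAt_congr fun _ hi => by rwa [mem_singleton.1 hi]

theorem sum_marginAt_singleton_update (T : (∀ j, Fin (a j)) → B) (j : Fin n)
    (k w : ∀ j, Fin (a j)) :
    ∑ i, marginAt T {j} (Function.update k j i) = marginAt T ∅ w := by
  rw [← insert_empty, sum_marginAt_update (notMem_empty j)]
  exact marginAt_congr (by simp)

theorem sum_marginAt_pair_update (T : (∀ j, Fin (a j)) → B) (hl : l ≠ j) (k : ∀ j, Fin (a j)) :
    ∑ i, marginAt T {j, l} (Function.update k l i) = marginAt T {j} k := by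
  rw [pair_comm]
  exact sum_marginAt_update (notMem_singleton.2 hl) k

end AddCommMonoid

section CommSemiring

variable {B : Type*} [CommSemiring B] {T : (∀ j, Fin (a j)) → B}

theorem IsSegre.marginAt_pair_mul_singleton (h : IsSegre (marginAt T {j, l})) (hl : l ≠ j)
    (v w : ∀ j, Fin (a j)) :
    marginAt T {j, l} v * marginAt T {j} w =
      marginAt T {j} v * marginAt T {j, l} (Function.update v j (w j)) := by
  rw [← marginAt_singleton_congr (Function.update_self j (v j) w),
    ← sum_marginAt_pair_update T hl, ← sum_marginAt_pair_update T hl, mul_sum, sum_mul]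
  refine sum_congr rfl fun x _ => ?_
  rw [h j, Function.update_comm hl.symm, Function.update_of_ne hl.symm]

theorem IsSegre.marginAt_pair_mul_total (h : IsSegre (marginAt T {j, l})) (hl : l ≠ j)
    (v w : ∀ j, Fin (a j)) :
    marginAt T {j, l} v * marginAt T ∅ w = marginAt T {j} v * marginAt T {l} v := by
  rw [← sum_marginAt_pair_update T hl.symm, ← sum_marginAt_singleton_update T j v w, mul_sum,
    mul_sum]
  refine sum_congr rfl fun x _ => ?_
  rw [h.marginAt_pair_mul_singleton hl, Function.update_self, pair_comm]

end CommSemiring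

variable {F : Type*} [Field F] {T : (∀ j, Fin (a j)) → F}

theorem IsGraph.exists_marginAt_eq_prod_of_total_ne_zero (hΔ : IsGraph Δ) (j₀ : Fin n)
    (hT : ∀ J ∈ Δ, IsSegre (marginAt T J)) {o : ∀ j, Fin (a j)} (ho : marginAt T ∅ o ≠ 0) :
    ∃ η : ∀ j, Fin (a j) → F,
      ∀ J ∈ Δ, ∀ k, marginAt T J k = marginAt (fun k => ∏ j, η j (k j)) J k := by
  set t := marginAt T ∅ o with ht
  let η : ∀ j, Fin (a j) → F := fun j i =>
    (if j = j₀ then t else 1) * (marginAt T {j} (Function.update o j i) * t⁻¹)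
  refine ⟨η, fun J hJ k => ?_⟩
  have hfactor : ∀ j, (if j ∈ J then η j (k j) else ∑ i, η j i) =
      (if j = j₀ then t else 1) * (if j ∈ J then marginAt T {j} k * t⁻¹ else 1) := fun j => by
    simp only [η]
    rw [← mul_sum, ← sum_mul, sum_marginAt_singleton_update T j o o, ← ht, mul_inv_cancel₀ ho,
      marginAt_singleton_congr (Function.update_self j (k j) o), mul_ite]
  rw [marginAt_prod η, prod_congr rfl fun j _ => hfactor j, prod_mul_distrib, prod_ite_eq',
    if_pos (mem_univ j₀), prod_ite_mem, univ_inter]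
  rcases hΔ.face_cases hJ with rfl | ⟨j, rfl⟩ | ⟨j, l, hjl, rfl⟩
  · rw [prod_empty, mul_one]
    exact marginAt_congr (by simp)
  · rw [prod_singleton]
    field_simp
  · rw [prod_pair hjl]
    have hmul := (hT _ hJ).marginAt_pair_mul_total hjl.symm k o
    field_simp
    rw [← hmul, mul_comm]

theorem IsGraph.exists_marginAt_eq_prod_of_singleton_ne_zero (hΔ : IsGraph Δ)
    (hT : ∀ J ∈ Δ, IsSegre (marginAt T J)) {v : ∀ j, Fin (a j)} (hv : marginAt T {j} v ≠ 0) :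
    ∃ η : ∀ j, Fin (a j) → F,
      ∀ J ∈ facesAt Δ j, ∀ k, marginAt T J k = marginAt (fun k => ∏ j, η j (k j)) J k := by
  let η : ∀ l, Fin (a l) → F := fun l i => if l = j then marginAt T {j} (Function.update v l i)
    else marginAt T {j, l} (Function.update v l i) / marginAt T {j} v
  refine ⟨η, ?_⟩
  rintro J ⟨hJ, hj⟩ k
  have hone : ∀ l, l ≠ j → ∑ i, η l i = 1 := fun l hl => by
    simp only [η, if_neg hl]
    rw [← sum_div, sum_marginAt_pair_update T hl, div_self hv]
  have hself : η j (k j) = marginAt T {j} k :=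
    (if_pos rfl).trans (marginAt_singleton_congr (Function.update_self ..))
  rw [marginAt_prod η]
  rcases hΔ.face_cases_of_mem hJ hj with rfl | ⟨l, hl, rfl⟩
  · rw [prod_eq_single j (fun l _ hl => by simpa [hl] using hone l hl) (by simp)]
    simpa using hself.symm
  · rw [prod_eq_mul j l hl.symm (fun i _ hi => by simpa [hi] using hone i hi.1) (by simp) (by simp)]
    simp only [mem_insert, mem_singleton, true_or, or_true, if_true]
    have hswap : marginAt T {j, l} (Function.update k j (v j)) =
        marginAt T {j, l} (Function.update v l (k l)) :=
      marginAt_congr (by simp [hl, hl.symm])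
    simp only [hself, η, if_neg hl]
    rw [mul_div_assoc', eq_div_iff hv, ← hswap]
    exact (hT _ hJ).marginAt_pair_mul_singleton hl k v

end FieldValued

section PrimeOverIndependenceIdeal

variable {K : Type*} [Field K] {n : ℕ} {a : Fin n → ℕ} {Δ : Set (Finset (Fin n))}
  {𝔭 : Ideal (TableRing K a)} [𝔭.IsPrime]

/-- The value at the generic point of `𝔭` of the generic table, a table over the residue field. -/
noncomputable abbrev residueTable (𝔭 : Ideal (TableRing K a)) [𝔭.IsPrime] (k : ∀ j, Fin (a j)) :
    𝔭.ResidueField :=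
  algebraMap (TableRing K a) 𝔭.ResidueField (genericTable K a k)

theorem marginAt_residueTable_eq_zero_iff (J : Finset (Fin n)) (k : ∀ j, Fin (a j)) :
    marginAt (residueTable 𝔭) J k = 0 ↔ marginAt (genericTable K a) J k ∈ 𝔭 := by
  rw [← Ideal.algebraMap_residueField_eq_zero, map_marginAt]
  rfl

theorem isSegre_marginAt_residueTable (o : ∀ j, Fin (a j)) (hI : independenceIdeal K a Δ ≤ 𝔭) :
    ∀ J ∈ Δ, IsSegre (marginAt (residueTable 𝔭) J) :=
  (independenceIdeal_le_ker_iff o _).1 (hI.trans 𝔭.ker_algebraMap_residueField.ge)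

theorem mainPrime_le_of_marginAt_residueTable_eq_prod (o : ∀ j, Fin (a j))
    (h : ∃ η : ∀ j, Fin (a j) → 𝔭.ResidueField, ∀ J ∈ Δ, ∀ k,
      marginAt (residueTable 𝔭) J k = marginAt (fun k => ∏ j, η j (k j)) J k) :
    mainPrime K a Δ ≤ 𝔭 := by
  obtain ⟨η, hη⟩ := h
  have hker : mainPrime K a Δ ≤
      RingHom.ker (IsScalarTower.toAlgHom K (TableRing K a) 𝔭.ResidueField) :=
    mainPrime_le_ker fun J hJ => (margin_eq_iff o).2 (hη J hJ)
  exact hker.trans 𝔭.ker_algebraMap_residueField.le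

theorem nonempty_of_not_mainPrime_le (o : ∀ j, Fin (a j)) (hP : ¬ mainPrime K a Δ ≤ 𝔭) :
    Δ.Nonempty := by
  by_contra hne
  rw [Set.not_nonempty_iff_eq_empty] at hne
  subst hne
  exact hP (mainPrime_le_of_marginAt_residueTable_eq_prod o ⟨fun _ _ => 0, by simp⟩)

theorem IsGraph.exists_edge (hΔ : IsGraph Δ) (hne : Δ.Nonempty) :
    ∃ j l, j ≠ l ∧ IsFacet Δ {j, l} := by
  obtain ⟨J, hJ⟩ := hne
  obtain ⟨F, hF, -⟩ := exists_isFacet_superset hJ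
  obtain ⟨j, l, hjl, rfl⟩ := card_eq_two.1 (hΔ.card_facet F hF)
  exact ⟨j, l, hjl, hF⟩

theorem IsGraph.marginAt_empty_mem (hΔ : IsGraph Δ) (hI : independenceIdeal K a Δ ≤ 𝔭)
    (hP : ¬ mainPrime K a Δ ≤ 𝔭) (o : ∀ j, Fin (a j)) : marginAt (genericTable K a) ∅ o ∈ 𝔭 := by
  by_contra ho
  obtain ⟨j, -⟩ := hΔ.exists_edge (nonempty_of_not_mainPrime_le o hP)
  exact hP (mainPrime_le_of_marginAt_residueTable_eq_prod o
    (hΔ.exists_marginAt_eq_prod_of_total_ne_zero j (isSegre_marginAt_residueTable o hI)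
      (mt (marginAt_residueTable_eq_zero_iff ∅ o).1 ho)))

theorem IsGraph.mainPrime_facesAt_le (hΔ : IsGraph Δ) (o : ∀ j, Fin (a j))
    (hI : independenceIdeal K a Δ ≤ 𝔭) {j : Fin n} (hj : ¬ marginIdeal K a {j} ≤ 𝔭) :
    mainPrime K a (facesAt Δ j) ≤ 𝔭 := by
  rw [marginIdeal_le_iff o, not_forall] at hj
  obtain ⟨v, hv⟩ := hj
  exact mainPrime_le_of_marginAt_residueTable_eq_prod o
    (hΔ.exists_marginAt_eq_prod_of_singleton_ne_zero (isSegre_marginAt_residueTable o hI)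
      (mt (marginAt_residueTable_eq_zero_iff {j} v).1 hv))

theorem IsGraph.isVertexCover_of_marginAt_empty_mem (hΔ : IsGraph Δ) {o : ∀ j, Fin (a j)}
    (hI : independenceIdeal K a Δ ≤ 𝔭) (ho : marginAt (genericTable K a) ∅ o ∈ 𝔭)
    {Γ : Finset (Fin n)} (hΓ : ∀ j ∉ Γ, ¬ marginIdeal K a {j} ≤ 𝔭) : IsVertexCover Δ Γ := by
  intro F hF
  obtain ⟨j, l, hjl, rfl⟩ := card_eq_two.1 (hΔ.card_facet F hF)
  by_contra! hnot
  have hj := hΓ j (hnot j (by simp))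
  have hl := hΓ l (hnot l (by simp))
  simp only [marginIdeal_le_iff o, not_forall, ← marginAt_residueTable_eq_zero_iff] at hj hl
  obtain ⟨v, hv⟩ := hj
  obtain ⟨w, hw⟩ := hl
  have hmul := (isSegre_marginAt_residueTable o hI _ hF.1).marginAt_pair_mul_total hjl.symm
    (Function.update v l (w l)) o
  rw [(marginAt_residueTable_eq_zero_iff ∅ o).2 ho, mul_zero,
    marginAt_singleton_congr (Function.update_of_ne hjl _ _),
    marginAt_singleton_congr (Function.update_self l (w l) v)] at hmul
  exact mul_ne_zero hv hw hmul.symm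

end PrimeOverIndependenceIdeal

section CoverIdeal

variable {K : Type*} [Field K] {n : ℕ} {a : Fin n → ℕ} {Δ : Set (Finset (Fin n))}
  {Γ S T : Finset (Fin n)} {p l : Fin n}

/-- The ideal attached to a set `Γ` of vertices, `I_Δ + ∑_{j ∉ Γ} P_{Δ(j)} + ∑_{j ∈ Γ} L_{j}`. -/
noncomputable def coverIdeal (K : Type*) [Field K] {n : ℕ} (a : Fin n → ℕ)
    (Δ : Set (Finset (Fin n))) (Γ : Finset (Fin n)) : Ideal (TableRing K a) :=
  independenceIdeal K a Δ ⊔ (⨆ j ∈ Γᶜ, mainPrime K a (facesAt Δ j)) ⊔ ⨆ j ∈ Γ, marginIdeal K a {j}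

theorem coverIdeal_le_iff {I : Ideal (TableRing K a)} :
    coverIdeal K a Δ Γ ≤ I ↔ independenceIdeal K a Δ ≤ I ∧
      (∀ j ∉ Γ, mainPrime K a (facesAt Δ j) ≤ I) ∧ ∀ j ∈ Γ, marginIdeal K a {j} ≤ I := by
  simp only [coverIdeal, sup_le_iff, iSup_le_iff, mem_compl, and_assoc]

theorem supportMargin_mem_coverIdeal (hΓ : Γ.Nonempty) {o k : ∀ j, Fin (a j)}
    (hk : indexSupport o k ⊆ Γ) (hcard : #(indexSupport o k) ≤ 1) :
    supportMargin o (genericTable K a) k ∈ coverIdeal K a Δ Γ := by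
  have hmem : ∀ j ∈ Γ, ∀ k, marginAt (genericTable K a) {j} k ∈ coverIdeal K a Δ Γ := fun j hj =>
    (marginIdeal_le_iff o _).1 ((coverIdeal_le_iff.1 le_rfl).2.2 j hj)
  rw [supportMargin]
  rcases Nat.le_one_iff_eq_zero_or_eq_one.1 hcard with h | h
  · obtain ⟨j, hj⟩ := hΓ
    rw [card_eq_zero.1 h, ← sum_marginAt_singleton_update _ j k k]
    exact sum_mem fun i _ => hmem j hj _
  · obtain ⟨j, h⟩ := card_eq_one.1 h
    rw [h] at hk ⊢
    exact hmem j (singleton_subset_iff.1 hk) k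

theorem mul_sub_mul_mem_coverIdeal (hS : S ∈ Δ) (hT : T ∈ Δ) (hpS : p ∈ S) (hpT : p ∈ T)
    (hST : p ∈ Γ → S = T) (v w : ∀ j, Fin (a j)) :
    marginAt (genericTable K a) S v * marginAt (genericTable K a) T w -
      marginAt (genericTable K a) T (Function.update w p (v p)) *
        marginAt (genericTable K a) S (Function.update v p (w p)) ∈ coverIdeal K a Δ Γ := by
  obtain ⟨hI, hP, -⟩ := coverIdeal_le_iff.1 (le_refl (coverIdeal K a Δ Γ))
  by_cases hp : p ∈ Γ
  · obtain rfl := hST hp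
    rw [← Ideal.mk_ker (I := coverIdeal K a Δ Γ), independenceIdeal_le_ker_iff v] at hI
    have hsegre := hI S hS p v w
    simp only [← map_marginAt, ← map_mul] at hsegre
    exact Ideal.Quotient.eq.1 hsegre
  · exact hP p hp (mul_sub_mul_mem_mainPrime (Δ := facesAt Δ p) ⟨hS, hpS⟩ ⟨hT, hpT⟩
      (iff_of_true hpS hpT) v w)

theorem indexSupport_update {o k : ∀ j, Fin (a j)} {i : Fin (a p)} (hk : k p ≠ o p)
    (hi : i ≠ o p) : indexSupport o (Function.update k p i) = indexSupport o k := by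
  ext j
  rcases eq_or_ne j p with rfl | hj
  · simp [mem_indexSupport, hk, hi]
  · simp [mem_indexSupport, hj]

end CoverIdeal

section Block

variable {n : ℕ} {a : Fin n → ℕ} {Δ : Set (Finset (Fin n))} {Γ S S' : Finset (Fin n)}
  {p l : Fin n}

/-- The part of `S` that is remembered by its block. -/
def blockVertices (Γ S : Finset (Fin n)) : Finset (Fin n) :=
  if S ⊆ Γ then S else S \ Γ

open Classical in
/-- The label of the block containing the coordinates `supportMargin o T k` with
`indexSupport o k = S`, together with the vertices, at most one, that index its rows; the other
vertices index its columns. Coordinates of non-faces lie in blocks with a single row. -/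
noncomputable def block (Δ : Set (Finset (Fin n))) (Γ S : Finset (Fin n)) :
    Finset (Fin n) × Finset (Fin n) :=
  (blockVertices Γ S,
    if S ∈ Δ then {j ∈ blockVertices Γ S | ∀ i ∈ blockVertices Γ S, j ≤ i} else ∅)

theorem blockVertices_subset : blockVertices Γ S ⊆ S := by
  unfold blockVertices
  split_ifs
  exacts [Subset.rfl, sdiff_subset]

theorem blockVertices_eq_of_mem (hp : p ∈ blockVertices Γ S) (hpΓ : p ∈ Γ) :
    blockVertices Γ S = S := by
  unfold blockVertices at hp ⊢
  split_ifs at hp ⊢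
  · rfl
  · exact absurd hpΓ (mem_sdiff.1 hp).2

theorem mem_block_snd : p ∈ (block Δ Γ S).2 ↔
    S ∈ Δ ∧ p ∈ blockVertices Γ S ∧ ∀ i ∈ blockVertices Γ S, p ≤ i := by
  unfold block
  split_ifs with hS <;> simp [hS]

theorem block_snd_eq_singleton (hp : p ∈ (block Δ Γ S).2) : (block Δ Γ S).2 = {p} := by
  refine eq_singleton_iff_unique_mem.2 ⟨hp, fun q hq => ?_⟩
  rw [mem_block_snd] at hp hq
  exact le_antisymm (hq.2.2 p hp.2.1) (hp.2.2 q hq.2.1)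

theorem block_eq_pair (hΔ : ∀ S ⊆ {p, l}, S ∈ Δ) (hlΓ : l ∈ Γ)
    (hS : S ⊆ {p, l}) (hpS : p ∈ S) (hpΓ : p ∈ Γ → p < l ∧ l ∈ S) :
    block Δ Γ S = (if p ∈ Γ then {p, l} else {p}, {p}) := by
  have hvertices : blockVertices Γ S = if p ∈ Γ then {p, l} else {p} := by
    unfold blockVertices
    split_ifs with hSΓ hp hp
    · exact hS.antisymm (insert_subset hpS (singleton_subset_iff.2 (hpΓ hp).2))
    · exact absurd (hSΓ hpS) hp
    · exact absurd (hS.trans (insert_subset hp (singleton_subset_iff.2 hlΓ))) hSΓ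
    · ext j
      have := @hS j
      grind
  rw [block, if_pos (hΔ S hS), hvertices]
  congr 1
  ext j
  split_ifs with hp
  · have := (hpΓ hp).1
    grind
  · grind

/-- The row of its block in which the coordinate at `k` lies. -/
noncomputable def blockRow (Δ : Set (Finset (Fin n))) (Γ : Finset (Fin n)) (o k : ∀ j, Fin (a j)) :
    (Finset (Fin n) × Finset (Fin n)) × (∀ j, Fin (a j)) :=
  (block Δ Γ (indexSupport o k), (block Δ Γ (indexSupport o k)).2.piecewise k o)

/-- The column of its block in which the coordinate at `k` lies. -/
noncomputable def blockCol (Δ : Set (Finset (Fin n))) (Γ : Finset (Fin n)) (o k : ∀ j, Fin (a j)) :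
    (Finset (Fin n) × Finset (Fin n)) × (∀ j, Fin (a j)) :=
  (block Δ Γ (indexSupport o k), (block Δ Γ (indexSupport o k)).2.piecewise o k)

variable {o k k' : ∀ j, Fin (a j)}

theorem blockRow_eq_iff : blockRow Δ Γ o k = blockRow Δ Γ o k' ↔
    block Δ Γ (indexSupport o k) = block Δ Γ (indexSupport o k') ∧
      ∀ j ∈ (block Δ Γ (indexSupport o k')).2, k j = k' j := by
  rw [blockRow, blockRow, Prod.mk.injEq]
  refine and_congr_right fun h => ?_
  rw [h, funext_iff]
  refine forall_congr' fun j => ?_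
  by_cases hj : j ∈ (block Δ Γ (indexSupport o k')).2 <;> simp [hj]

theorem blockCol_eq_iff : blockCol Δ Γ o k = blockCol Δ Γ o k' ↔
    block Δ Γ (indexSupport o k) = block Δ Γ (indexSupport o k') ∧
      ∀ j ∉ (block Δ Γ (indexSupport o k')).2, k j = k' j := by
  rw [blockCol, blockCol, Prod.mk.injEq]
  refine and_congr_right fun h => ?_
  rw [h, funext_iff]
  refine forall_congr' fun j => ?_
  by_cases hj : j ∈ (block Δ Γ (indexSupport o k')).2 <;> simp [hj]

theorem eq_of_blockRow_eq_of_blockCol_eq (hrow : blockRow Δ Γ o k = blockRow Δ Γ o k')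
    (hcol : blockCol Δ Γ o k = blockCol Δ Γ o k') : k = k' :=
  funext fun j => (em _).elim ((blockRow_eq_iff.1 hrow).2 j) ((blockCol_eq_iff.1 hcol).2 j)

theorem exists_block_exchange (K : Type*) [Field K] {v w x : ∀ j, Fin (a j)}
    (hv : blockRow Δ Γ o v = blockRow Δ Γ o x) (hw : blockCol Δ Γ o w = blockCol Δ Γ o x) :
    ∃ y, blockRow Δ Γ o y = blockRow Δ Γ o w ∧ blockCol Δ Γ o y = blockCol Δ Γ o v ∧
      supportMargin o (genericTable K a) v * supportMargin o (genericTable K a) w -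
        supportMargin o (genericTable K a) x * supportMargin o (genericTable K a) y ∈
          coverIdeal K a Δ Γ := by
  obtain ⟨hvb, hvx⟩ := blockRow_eq_iff.1 hv
  obtain ⟨hwb, hwx⟩ := blockCol_eq_iff.1 hw
  have hvwb := hvb.trans hwb.symm
  rcases (block Δ Γ (indexSupport o x)).2.eq_empty_or_nonempty with hC | ⟨p, hp⟩
  · obtain rfl : w = x := funext fun j => hwx j (by simp [hC])
    exact ⟨v, hv, rfl, by simp [mul_comm]⟩
  have hpv : p ∈ (block Δ Γ (indexSupport o v)).2 := hvb ▸ hp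
  have hpw : p ∈ (block Δ Γ (indexSupport o w)).2 := hwb ▸ hp
  have hC := block_snd_eq_singleton hp
  obtain ⟨hvΔ, hvp, -⟩ := mem_block_snd.1 hpv
  obtain ⟨hwΔ, hwp, -⟩ := mem_block_snd.1 hpw
  have hvw : p ∈ Γ → indexSupport o v = indexSupport o w := fun hpΓ => by
    rw [← blockVertices_eq_of_mem hvp hpΓ, ← blockVertices_eq_of_mem hwp hpΓ]
    exact congr_arg Prod.fst hvwb
  replace hvp := mem_indexSupport.1 (blockVertices_subset hvp)
  replace hwp := mem_indexSupport.1 (blockVertices_subset hwp)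
  obtain rfl : Function.update w p (v p) = x := Function.update_eq_iff.2
    ⟨hvx p hp, fun j hj => hwx j (by rwa [hC, mem_singleton])⟩
  have hy := indexSupport_update hvp hwp
  refine ⟨Function.update v p (w p), ?_, ?_, ?_⟩
  · rw [blockRow_eq_iff, hy, block_snd_eq_singleton hpw]
    exact ⟨hvwb, by simp⟩
  · rw [blockCol_eq_iff, hy, block_snd_eq_singleton hpv]
    exact ⟨rfl, fun j hj => Function.update_of_ne (mt mem_singleton.2 hj) _ _⟩
  · rw [supportMargin, supportMargin, supportMargin, supportMargin, hy, indexSupport_update hwp hvp]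
    exact mul_sub_mul_mem_coverIdeal hvΔ hwΔ (mem_indexSupport.2 hvp) (mem_indexSupport.2 hwp)
      hvw v w

end Block

section BlockMonomial

variable {n : ℕ} {a : Fin n → ℕ} {Δ : Set (Finset (Fin n))} {Γ J : Finset (Fin n)}
  {o k : ∀ j, Fin (a j)} {p l : Fin n}

/-- The variables for the rows and the columns of all blocks. -/
abbrev BlockVar (a : Fin n → ℕ) : Type :=
  (Finset (Fin n) × Finset (Fin n)) × (∀ j, Fin (a j)) ⊕
    (Finset (Fin n) × Finset (Fin n)) × (∀ j, Fin (a j))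

/-- The toric parametrization of the coordinates `supportMargin o T`: each block becomes the rank
one matrix of products of a row variable and a column variable, except that the coordinates which
visibly belong to `coverIdeal K a Δ Γ` become zero. -/
noncomputable def blockMonomial (K : Type*) [CommSemiring K] (Δ : Set (Finset (Fin n)))
    (Γ : Finset (Fin n)) (o : ∀ j, Fin (a j)) : (∀ j, Fin (a j)) → MvPolynomial (BlockVar a) K :=
  {k | indexSupport o k ⊆ Γ → 1 < #(indexSupport o k)}.indicator fun k =>
    X (.inl (blockRow Δ Γ o k)) * X (.inr (blockCol Δ Γ o k))

theorem ker_aeval_blockMonomial_le (K : Type*) [Field K] (hΓ : Γ.Nonempty) :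
    RingHom.ker (aeval (R := K) (blockMonomial K Δ Γ o)) ≤ RingHom.ker (aeval (R := K)
      (Ideal.Quotient.mk (coverIdeal K a Δ Γ) ∘ supportMargin o (genericTable K a))) := by
  refine ker_aeval_indicator_mul_le (fun v w => eq_of_blockRow_eq_of_blockCol_eq)
    (fun k hk => ?_) fun v w x hv hw => ?_
  · rw [Set.mem_ofPred_eq, Classical.not_imp, not_lt] at hk
    exact Ideal.Quotient.eq_zero_iff_mem.2 (supportMargin_mem_coverIdeal hΓ hk.1 hk.2)
  · obtain ⟨y, hyr, hyc, hy⟩ := exists_block_exchange K hv hw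
    refine ⟨y, hyr, hyc, ?_⟩
    simp only [Function.comp_apply, ← map_mul]
    exact Ideal.Quotient.eq.2 hy

theorem blockMonomial_eq_mul (K : Type*) [CommSemiring K] (hpl : p ≠ l) (hΔ : ∀ S ⊆ {p, l}, S ∈ Δ)
    (hlΓ : l ∈ Γ) (hpΓ : p ∈ Γ → p < l) (hk : indexSupport o k ⊆ {p, l}) :
    blockMonomial K Δ Γ o k =
      (if k p = o p then 0 else
        X (.inl ((if p ∈ Γ then {p, l} else {p}, {p}), Function.update o p (k p)))) *
      (if p ∈ Γ ∧ k l = o l then 0 else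
        X (.inr ((if p ∈ Γ then {p, l} else {p}, {p}), Function.update o l (k l)))) := by
  have hzero : ∀ j ∈ Γ, indexSupport o k ⊆ {j} → blockMonomial K Δ Γ o k = 0 := fun j hj hkj =>
    Set.indicator_of_notMem (fun h => (h (hkj.trans (singleton_subset_iff.2 hj))).not_ge
      ((card_le_card hkj).trans_eq (card_singleton j))) _
  have hmem : ∀ j, j ∈ indexSupport o k ↔ k j ≠ o j := fun j => mem_indexSupport
  by_cases hkp : k p = o p
  · rw [if_pos hkp, zero_mul, hzero l hlΓ (by grind)]
  rw [if_neg hkp]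
  by_cases hkl : p ∈ Γ ∧ k l = o l
  · rw [if_pos hkl, mul_zero, hzero p hkl.1 (by grind)]
  rw [if_neg hkl]
  have hp : p ∈ indexSupport o k := (hmem p).2 hkp
  have hl : p ∈ Γ → l ∈ indexSupport o k := fun hp => (hmem l).2 fun h => hkl ⟨hp, h⟩
  have hcol : Function.update k p (o p) = Function.update o l (k l) := by
    ext j
    have := indexSupport_subset_iff.1 hk j
    grind
  rw [blockMonomial, Set.indicator_of_mem, blockRow, blockCol,
    block_eq_pair hΔ hlΓ hk hp fun h => ⟨hpΓ h, hl h⟩, piecewise_singleton,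
    piecewise_singleton, hcol]
  exact fun hΓ => one_lt_card.2 ⟨p, hp, l, hl (hΓ hp), hpl⟩

theorem isSegre_marginAt_of_supportMargin_eq_blockMonomial {K : Type*} [CommRing K]
    {T : (∀ j, Fin (a j)) → MvPolynomial (BlockVar a) K}
    (hT : supportMargin o T = blockMonomial K Δ Γ o) (hpl : p ≠ l) (hΔ : ∀ S ⊆ {p, l}, S ∈ Δ)
    (hlΓ : l ∈ Γ) (hpΓ : p ∈ Γ → p < l) : IsSegre (marginAt T {p, l}) := by
  let b : Finset (Fin n) × Finset (Fin n) := (if p ∈ Γ then {p, l} else {p}, {p})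
  let α : ∀ j, Fin (a j) → MvPolynomial (BlockVar a) K := fun j i =>
    (if j = p then if i = o j then 0 else X (.inl (b, Function.update o j i)) else 1) *
      (if j = l then if p ∈ Γ ∧ i = o j then 0 else X (.inr (b, Function.update o j i)) else 1)
  refine isSegre_marginAt_of_supportMargin_eq_prod (o := o) α fun k hk => ?_
  simp only [hT, blockMonomial_eq_mul K hpl hΔ hlΓ hpΓ hk, α, prod_mul_distrib, prod_ite_eq',
    mem_univ, if_true]
  rfl

theorem IsVertexCover.exists_eq_pair (hΓ : IsVertexCover Δ Γ) (hΔ : IsGraph Δ) (hJ : J ∈ Δ)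
    (hcard : 1 < #J) : ∃ p l, p ≠ l ∧ J = {p, l} ∧ l ∈ Γ ∧ (p ∈ Γ → p < l) := by
  obtain ⟨F, hF, hJF⟩ := exists_isFacet_superset hJ
  obtain rfl : J = F := eq_of_subset_of_card_le hJF (by rwa [hΔ.card_facet F hF])
  obtain ⟨p, l, hpl, rfl⟩ := card_eq_two.1 (hΔ.card_facet J hF)
  have hcover := hΓ _ hF
  simp only [mem_insert, mem_singleton, exists_eq_or_imp, exists_eq_left] at hcover
  by_cases h : l ∈ Γ ∧ (p ∈ Γ → p < l)
  · exact ⟨p, l, hpl, rfl, h⟩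
  · exact ⟨l, p, hpl.symm, pair_comm p l, by grind⟩

theorem IsVertexCover.exists_isPrime_le_coverIdeal (K : Type*) [Field K]
    (hΓ : IsVertexCover Δ Γ) (hΔ : IsGraph Δ) (hne : Γ.Nonempty) (o : ∀ j, Fin (a j)) :
    ∃ 𝔭 : Ideal (TableRing K a), 𝔭.IsPrime ∧ independenceIdeal K a Δ ≤ 𝔭 ∧
      𝔭 ≤ coverIdeal K a Δ Γ := by
  obtain ⟨T, hT⟩ := exists_supportMargin_eq o (blockMonomial K Δ Γ o)
  refine ⟨RingHom.ker (aeval (R := K) T), RingHom.ker_isPrime _, ?_, fun x hx => ?_⟩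
  · refine (independenceIdeal_le_ker_iff o (aeval (R := K) T).toRingHom).2 fun J hJ => ?_
    have hcomp : (aeval (R := K) T).toRingHom ∘ genericTable K a = T := aeval_comp_genericTable T
    rw [hcomp]
    rcases le_or_gt #J 1 with hcard | hcard
    · exact isSegre_marginAt_of_card_le_one hcard
    · obtain ⟨p, l, hpl, rfl, hlΓ, hpΓ⟩ := hΓ.exists_eq_pair hΔ hJ hcard
      exact isSegre_marginAt_of_supportMargin_eq_blockMonomial hT hpl (hΔ.down_closed _ hJ) hlΓ hpΓ
  · obtain ⟨q, rfl⟩ := aeval_supportMargin_genericTable_surjective K o x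
    have hq : q ∈ RingHom.ker (aeval (R := K) (blockMonomial K Δ Γ o)) := by
      rw [RingHom.mem_ker] at hx ⊢
      simpa only [comp_aeval_apply, map_supportMargin, aeval_comp_genericTable, hT] using hx
    have hmk := ker_aeval_blockMonomial_le K hne hq
    rw [RingHom.mem_ker] at hmk
    rw [← Ideal.Quotient.eq_zero_iff_mem, ← hmk]
    exact comp_aeval_apply _ (Ideal.Quotient.mkₐ K (coverIdeal K a Δ Γ)) q

theorem IsVertexCover.nonempty (hΓ : IsVertexCover Δ Γ) (hΔ : Δ.Nonempty) : Γ.Nonempty := by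
  obtain ⟨J, hJ⟩ := hΔ
  obtain ⟨F, hF, -⟩ := exists_isFacet_superset hJ
  obtain ⟨j, -, hj⟩ := hΓ F hF
  exact ⟨j, hj⟩

end BlockMonomial

section MinimalPrime

variable {K : Type*} [Field K] {n : ℕ} {a : Fin n → ℕ} {Δ : Set (Finset (Fin n))}

theorem mainPrime_eq_bot_of_isEmpty [IsEmpty (∀ j, Fin (a j))] : mainPrime K a Δ = ⊥ :=
  eq_bot_of_isEmpty fun h =>
    RingHom.ker_ne_top (segreMap K a) (top_le_iff.1 (h ▸ mainPrime_le_ker_segreMap))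

theorem IsGraph.exists_coverIdeal_le (hΔ : IsGraph Δ) (o : ∀ j, Fin (a j))
    {𝔭 : Ideal (TableRing K a)} [𝔭.IsPrime] (hI : independenceIdeal K a Δ ≤ 𝔭)
    (hP : ¬ mainPrime K a Δ ≤ 𝔭) :
    ∃ Γ : Finset (Fin n), IsVertexCover Δ Γ ∧ coverIdeal K a Δ Γ ≤ 𝔭 := by
  classical
  let Γ : Finset (Fin n) := {j | marginIdeal K a {j} ≤ 𝔭}
  have hΓ : ∀ j, j ∈ Γ ↔ marginIdeal K a {j} ≤ 𝔭 := fun j => mem_filter_univ j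
  exact ⟨Γ, hΔ.isVertexCover_of_marginAt_empty_mem hI (hΔ.marginAt_empty_mem hI hP o)
      fun j => mt (hΓ j).2,
    coverIdeal_le_iff.2 ⟨hI, fun j hj => hΔ.mainPrime_facesAt_le o hI (mt (hΓ j).2 hj),
      fun j => (hΓ j).1⟩⟩

end MinimalPrime

end MarginTable

theorem mainTheorem9 (K : Type*) [Field K] {n : ℕ} (a : Fin n → ℕ)
    (Δ : Set (Finset (Fin n))) (hΔ : MarginTable.IsGraph Δ)
    (𝔞 : Ideal (MarginTable.TableRing K a))
    (h𝔞 : 𝔞 ∈ (MarginTable.independenceIdeal K a Δ).minimalPrimes) :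
    𝔞 = MarginTable.mainPrime K a Δ ∨
      ∃ Γ : Finset (Fin n), MarginTable.IsVertexCover Δ Γ ∧
        𝔞 = MarginTable.independenceIdeal K a Δ
            ⊔ (⨆ j ∈ Γᶜ, MarginTable.mainPrime K a (MarginTable.facesAt Δ j))
            ⊔ (⨆ j ∈ Γ, MarginTable.marginIdeal K a {j}) := by
  have := h𝔞.1.1
  rcases isEmpty_or_nonempty (∀ j, Fin (a j)) with _ | ⟨⟨o⟩⟩
  · rw [MarginTable.eq_bot_of_isEmpty this.ne_top, MarginTable.mainPrime_eq_bot_of_isEmpty]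
    exact .inl rfl
  by_cases hP : MarginTable.mainPrime K a Δ ≤ 𝔞
  · exact .inl <| le_antisymm (h𝔞.2 ⟨MarginTable.isPrime_mainPrime hΔ.down_closed o,
      MarginTable.independenceIdeal_le_mainPrime o⟩ hP) hP
  obtain ⟨Γ, hΓ, hcover⟩ := hΔ.exists_coverIdeal_le o h𝔞.1.2 hP
  obtain ⟨𝔭, h𝔭, hI, h𝔭cover⟩ := hΓ.exists_isPrime_le_coverIdeal K hΔ
    (hΓ.nonempty (MarginTable.nonempty_of_not_mainPrime_le o hP)) o
  exact .inr ⟨Γ, hΓ, le_antisymm ((h𝔞.2 ⟨h𝔭, hI⟩ (h𝔭cover.trans hcover)).trans h𝔭cover) hcover⟩
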